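/- Let $(M,g)$ be a smooth four-dimensional Lorentzian manifold of signature $(-,+,+,+)$ which is a spacetime of quasi-constant sectional curvature, i.e. there are a smooth unit timelike vector field $A$ (the generator, $A_iA^i=-1$; it time-orients $M$) and smooth functions $\gamma,\mu$ on $M$ such that $$R_{hijk}=\gamma\,(g_{hk}g_{ij}-g_{hj}g_{ik})+\mu\,(g_{hk}A_iA_j+g_{ij}A_hA_k-g_{hj}A_iA_k-g_{ik}A_hA_j).$$ Assume that $\mu$ vanishes nowhere and that $(M,g)$ is Ricci symmetric, i.e. $\nabla_l R_{ij}=0$, where $R_{hk}=g^{ij}R_{hijk}$. Then: 1. the generator is parallel: $\nabla_l A_j=0$; 2. the spacetime is static: it admits a smooth timelike Killing vector field $\rho$ that is irrotational, i.e. $\rho_{[i}\nabla_j\rho_{k]}=0$; 3. at every point the spacetime is of Petrov type I, D or O. Here, for a Lorentz frame $(e_0,e_1,e_2,e_3)$ at the point and the Weyl tensor $C$, let $Q=(Q_{ab})_{1\le a,b\le 3}$ be the complex trace-free symmetric matrix $Q_{ab}=C_{a0b0}+\tfrac{\mathrm i}{2}\sum_{c,d=1}^{3}\varepsilon_{acd}C_{cdb0}$;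 the type is I if $Q$ has three distinct eigenvalues, D if $Q$ is diagonalizable with exactly two distinct eigenvalues, and O if $Q=0$ (this does not depend on the frame). -/

import Mathlib

open scoped Manifold ContDiff

noncomputable section

namespace QCSpacetime

/-- The model space `ℝ⁴`, in which coordinate charts take their values. -/
abbrev E4 : Type := EuclideanSpace ℝ (Fin 4)

/-! ### Tensor calculus in one coordinate system

`G : E4 → Matrix (Fin 4) (Fin 4) ℝ` is the matrix function `g_{ij}` of the components of a
semi-Riemannian metric in a coordinate system. All indices run over `Fin 4`. -/

/-- The partial derivative `∂_l f` at the point `y` of coordinate space. -/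
def pd (l : Fin 4) (f : E4 → ℝ) (y : E4) : ℝ :=
  fderiv ℝ f y (EuclideanSpace.single l 1)

/-- Christoffel symbols of the Levi-Civita connection:
`Γ^k_{ij} = ½ g^{km} (∂_i g_{jm} + ∂_j g_{im} - ∂_m g_{ij})`. -/
def christoffel (G : E4 → Matrix (Fin 4) (Fin 4) ℝ) (k i j : Fin 4) (y : E4) : ℝ :=
  (1 / 2) * ∑ m, (G y)⁻¹ k m *
    (pd i (fun z => G z j m) y + pd j (fun z => G z i m) y - pd m (fun z => G z i j) y)

/-- The `p`-th component of `R(∂_h, ∂_i) ∂_j`, where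
`R(X, Y) Z = ∇_X ∇_Y Z - ∇_Y ∇_X Z - ∇_[X,Y] Z`. -/
def riemannUp (G : E4 → Matrix (Fin 4) (Fin 4) ℝ) (h i j p : Fin 4) (y : E4) : ℝ :=
  pd h (christoffel G p i j) y - pd i (christoffel G p h j) y
    + ∑ q, (christoffel G p h q y * christoffel G q i j y
        - christoffel G p i q y * christoffel G q h j y)

/-- The curvature tensor `R_{hijk} = g(R(∂_h, ∂_i) ∂_j, ∂_k)`. With this index convention
constant sectional curvature `K` means `R_{hijk} = K (g_{hk} g_{ij} - g_{hj} g_{ik})`. -/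
def riemann (G : E4 → Matrix (Fin 4) (Fin 4) ℝ) (h i j k : Fin 4) (y : E4) : ℝ :=
  ∑ p, riemannUp G h i j p y * G y p k

/-- The Ricci tensor `R_{hk} = g^{ij} R_{hijk}`. -/
def ricci (G : E4 → Matrix (Fin 4) (Fin 4) ℝ) (h k : Fin 4) (y : E4) : ℝ :=
  ∑ i, ∑ j, (G y)⁻¹ i j * riemann G h i j k y

/-- The scalar curvature `g^{hk} R_{hk}`. -/
def scalarCurv (G : E4 → Matrix (Fin 4) (Fin 4) ℝ) (y : E4) : ℝ :=
  ∑ h, ∑ k, (G y)⁻¹ h k * ricci G h k y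

/-- The Weyl conformal curvature tensor in dimension four. -/
def weyl (G : E4 → Matrix (Fin 4) (Fin 4) ℝ) (h i j k : Fin 4) (y : E4) : ℝ :=
  riemann G h i j k y
    - (1 / 2) * (G y h k * ricci G i j y - G y h j * ricci G i k y
        + G y i j * ricci G h k y - G y i k * ricci G h j y)
    + scalarCurv G y / 6 * (G y h k * G y i j - G y h j * G y i k)

/-- The covariant derivative `∇_l α_j = ∂_l α_j - Γ^k_{lj} α_k` of a covector field. -/
def covDeriv₁ (G : E4 → Matrix (Fin 4) (Fin 4) ℝ) (α : Fin 4 → E4 → ℝ)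
    (l j : Fin 4) (y : E4) : ℝ :=
  pd l (α j) y - ∑ k, christoffel G k l j y * α k y

/-- The covariant derivative `∇_l T_{ij} = ∂_l T_{ij} - Γ^k_{li} T_{kj} - Γ^k_{lj} T_{ik}` of
a covariant 2-tensor field. -/
def covDeriv₂ (G : E4 → Matrix (Fin 4) (Fin 4) ℝ) (T : Fin 4 → Fin 4 → E4 → ℝ)
    (l i j : Fin 4) (y : E4) : ℝ :=
  pd l (T i j) y - ∑ k, christoffel G k l i y * T k j y - ∑ k, christoffel G k l j y * T i k y

/-! ### Petrov types -/

/-- The Minkowski matrix `diag(-1, 1, 1, 1)`. -/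
def minkowski : Matrix (Fin 4) (Fin 4) ℝ := Matrix.diagonal ![-1, 1, 1, 1]

/-- The rows of `F` are the coordinate components of the vectors `e_0, …, e_3` of a Lorentz frame
at `y`: `g(e_a, e_b) = η_{ab}` (in particular `e_0` is unit timelike). -/
def IsLorentzFrame (G : E4 → Matrix (Fin 4) (Fin 4) ℝ) (y : E4)
    (F : Matrix (Fin 4) (Fin 4) ℝ) : Prop :=
  F * G y * F.transpose = minkowski

/-- The component `C(e_a, e_b, e_c, e_d)` of the Weyl tensor in the frame `F`. -/
def weylFrame (G : E4 → Matrix (Fin 4) (Fin 4) ℝ) (y : E4)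
    (F : Matrix (Fin 4) (Fin 4) ℝ) (a b c d : Fin 4) : ℝ :=
  ∑ h, ∑ i, ∑ j, ∑ k, weyl G h i j k y * F a h * F b i * F c j * F d k

/-- The complex `3 × 3` matrix `Q = E + i B` of the Weyl tensor relative to a Lorentz frame.
Its real part is the electric part `E_{ab} = C_{a0b0}`, its imaginary part the magnetic part
`B_{ab} = ½ ε_{acd} C_{cdb0}`, for spatial indices `a`, `b`. Spatial indices are
numbered cyclically by `Fin 3`, so that the latter is `C_{a+1,a+2,b,0}`. -/
def petrovMatrix (G : E4 → Matrix (Fin 4) (Fin 4) ℝ) (y : E4)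
    (F : Matrix (Fin 4) (Fin 4) ℝ) : Matrix (Fin 3) (Fin 3) ℂ :=
  Matrix.of fun a b =>
    (weylFrame G y F a.succ 0 b.succ 0 : ℂ)
      + Complex.I * (weylFrame G y F (a + 1).succ (a + 2).succ b.succ 0 : ℂ)

/-- Petrov type I at `y`: `Q` has three distinct eigenvalues. As for the other types, the choice
of the Lorentz frame does not matter (a change of frame replaces `Q` by a similar matrix or by
the complex conjugate of one). -/
def IsPetrovI (G : E4 → Matrix (Fin 4) (Fin 4) ℝ) (y : E4) : Prop :=
  ∃ F, IsLorentzFrame G y F ∧ ∃ a b c : ℂ, a ≠ b ∧ b ≠ c ∧ a ≠ c ∧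
    Module.End.HasEigenvalue (Matrix.toLin' (petrovMatrix G y F)) a ∧
    Module.End.HasEigenvalue (Matrix.toLin' (petrovMatrix G y F)) b ∧
    Module.End.HasEigenvalue (Matrix.toLin' (petrovMatrix G y F)) c

/-- Petrov type D at `y`: the trace-free matrix `Q` is diagonalizable with exactly two distinct
eigenvalues, i.e. it has minimal polynomial `(X - a)(X + a/2)` with `a ≠ 0`. -/
def IsPetrovD (G : E4 → Matrix (Fin 4) (Fin 4) ℝ) (y : E4) : Prop :=
  ∃ F, IsLorentzFrame G y F ∧ ∃ a : ℂ, a ≠ 0 ∧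
    (petrovMatrix G y F - a • 1) * (petrovMatrix G y F + (a / 2) • 1) = 0

/-- Petrov type O at `y`: `Q = 0`. -/
def IsPetrovO (G : E4 → Matrix (Fin 4) (Fin 4) ℝ) (y : E4) : Prop :=
  ∃ F, IsLorentzFrame G y F ∧ petrovMatrix G y F = 0

/-! ### Four-dimensional Lorentzian manifolds -/

attribute [local instance 2000] chartedSpaceSelf

variable (M : Type*) [TopologicalSpace M] [ChartedSpace E4 M] [IsManifold (𝓡 4) ∞ M]

/-- A smooth Lorentzian metric of signature `(-,+,+,+)` on a smooth 4-manifold. -/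
structure LorentzianMetric where
  /-- The bilinear form `g_x` on the tangent space at `x`. -/
  val : ∀ x : M, TangentSpace (𝓡 4) x →L[ℝ] TangentSpace (𝓡 4) x →L[ℝ] ℝ
  symm : ∀ (x : M) (v w : TangentSpace (𝓡 4) x), val x v w = val x w v
  signature : ∀ x : M, ∃ b : Module.Basis (Fin 4) ℝ (TangentSpace (𝓡 4) x),
    ∀ i j, val x (b i) (b j) = minkowski i j
  contMDiff : ContMDiff (𝓡 4) ((𝓡 4).prod 𝓘(ℝ, E4 →L[ℝ] E4 →L[ℝ] ℝ)) ∞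
    (fun x : M => Bundle.TotalSpace.mk' (E4 →L[ℝ] E4 →L[ℝ] ℝ)
      (E := fun x : M => TangentSpace (𝓡 4) x →L[ℝ] TangentSpace (𝓡 4) x →L[ℝ] ℝ) x (val x))

variable {M}

/-- A smooth vector field on `M`. -/
def IsSmoothVectorField (A : ∀ x : M, TangentSpace (𝓡 4) x) : Prop :=
  ContMDiff (𝓡 4) (𝓡 4).tangent ∞ (fun x : M => (⟨x, A x⟩ : TangentBundle (𝓡 4) M))

/-- The coordinate vector `∂_i` of the chart `e` at the point with coordinates `y ∈ e.target`. -/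
def coordVec (e : OpenPartialHomeomorph M E4) (i : Fin 4) (y : E4) :
    TangentSpace (𝓡 4) (e.symm y) :=
  mfderiv (𝓡 4) (𝓡 4) e.symm y (EuclideanSpace.single i (1 : ℝ) : E4)

/-- The component matrix `g_{ij} = g(∂_i, ∂_j)` of the metric in the chart `e`. -/
def LorentzianMetric.comp (g : LorentzianMetric M) (e : OpenPartialHomeomorph M E4) (y : E4) :
    Matrix (Fin 4) (Fin 4) ℝ :=
  Matrix.of fun i j => g.val (e.symm y) (coordVec e i y) (coordVec e j y)

/-- The covariant components `A_i = g(A, ∂_i)` of a vector field in the chart `e`. -/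
def LorentzianMetric.lower (g : LorentzianMetric M) (A : ∀ x : M, TangentSpace (𝓡 4) x)
    (e : OpenPartialHomeomorph M E4) (i : Fin 4) (y : E4) : ℝ :=
  g.val (e.symm y) (A (e.symm y)) (coordVec e i y)

/-! Tensor equations are required in all charts of the maximal smooth atlas. -/

/-- `(M, g)` is a spacetime of quasi-constant sectional curvature with generator `A` (a smooth unit
timelike vector field; it time-orients `M`) and associated scalars `γ`, `μ`. -/
structure IsQuasiConstant (g : LorentzianMetric M) (A : ∀ x : M, TangentSpace (𝓡 4) x)
    (γ μ : M → ℝ) : Prop where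
  smooth_generator : IsSmoothVectorField A
  smooth_gamma : ContMDiff (𝓡 4) 𝓘(ℝ, ℝ) ∞ γ
  smooth_mu : ContMDiff (𝓡 4) 𝓘(ℝ, ℝ) ∞ μ
  unit_timelike : ∀ x, g.val x (A x) (A x) = -1
  curvature : ∀ e ∈ IsManifold.maximalAtlas (𝓡 4) ∞ M, ∀ y ∈ e.target, ∀ h i j k : Fin 4,
    riemann (g.comp e) h i j k y =
      γ (e.symm y) * (g.comp e y h k * g.comp e y i j - g.comp e y h j * g.comp e y i k)
      + μ (e.symm y) *
        (g.comp e y h k * g.lower A e i y * g.lower A e j y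
          + g.comp e y i j * g.lower A e h y * g.lower A e k y
          - g.comp e y h j * g.lower A e i y * g.lower A e k y
          - g.comp e y i k * g.lower A e h y * g.lower A e j y)

/-- Ricci symmetry: `∇_l R_{ij} = 0`. -/
def IsRicciSymmetric (g : LorentzianMetric M) : Prop :=
  ∀ e ∈ IsManifold.maximalAtlas (𝓡 4) ∞ M, ∀ y ∈ e.target, ∀ l i j : Fin 4,
    covDeriv₂ (g.comp e) (ricci (g.comp e)) l i j y = 0

/-- The vector field `A` is parallel: `∇_l A_j = 0`. -/
def IsParallel (g : LorentzianMetric M) (A : ∀ x : M, TangentSpace (𝓡 4) x) : Prop :=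
  ∀ e ∈ IsManifold.maximalAtlas (𝓡 4) ∞ M, ∀ y ∈ e.target, ∀ l j : Fin 4,
    covDeriv₁ (g.comp e) (g.lower A e) l j y = 0

/-- Killing's equation `∇_i ρ_j + ∇_j ρ_i = 0`. -/
def IsKilling (g : LorentzianMetric M) (ρ : ∀ x : M, TangentSpace (𝓡 4) x) : Prop :=
  ∀ e ∈ IsManifold.maximalAtlas (𝓡 4) ∞ M, ∀ y ∈ e.target, ∀ i j : Fin 4,
    covDeriv₁ (g.comp e) (g.lower ρ e) i j y + covDeriv₁ (g.comp e) (g.lower ρ e) j i y = 0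

/-- The vector field `ρ` is irrotational (vorticity-free, i.e. hypersurface-orthogonal):
the total antisymmetrization of `ρ_i ∇_j ρ_k` vanishes. -/
def IsIrrotational (g : LorentzianMetric M) (ρ : ∀ x : M, TangentSpace (𝓡 4) x) : Prop :=
  ∀ e ∈ IsManifold.maximalAtlas (𝓡 4) ∞ M, ∀ y ∈ e.target, ∀ i j k : Fin 4,
    g.lower ρ e i y *
        (covDeriv₁ (g.comp e) (g.lower ρ e) j k y - covDeriv₁ (g.comp e) (g.lower ρ e) k j y)
      + g.lower ρ e j y *
        (covDeriv₁ (g.comp e) (g.lower ρ e) k i y - covDeriv₁ (g.comp e) (g.lower ρ e) i k y)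
      + g.lower ρ e k y *
        (covDeriv₁ (g.comp e) (g.lower ρ e) i j y - covDeriv₁ (g.comp e) (g.lower ρ e) j i y) = 0

/-- A static vector field: a smooth timelike irrotational Killing vector field. -/
structure IsStaticVectorField (g : LorentzianMetric M)
    (ρ : ∀ x : M, TangentSpace (𝓡 4) x) : Prop where
  smooth : IsSmoothVectorField ρ
  timelike : ∀ x, g.val x (ρ x) (ρ x) < 0
  killing : IsKilling g ρ
  irrotational : IsIrrotational g ρ

/-- `(M, g)` is static: it admits a static vector field. -/
def IsStatic (g : LorentzianMetric M) : Prop :=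
  ∃ ρ : ∀ x : M, TangentSpace (𝓡 4) x, IsStaticVectorField g ρ

/-- At every point, `(M, g)` is of Petrov type I, D or O. -/
def IsPetrovIDO (g : LorentzianMetric M) : Prop :=
  ∀ e ∈ IsManifold.maximalAtlas (𝓡 4) ∞ M, ∀ y ∈ e.target,
    IsPetrovI (g.comp e) y ∨ IsPetrovD (g.comp e) y ∨ IsPetrovO (g.comp e) y

end QCSpacetime

end

/-!
# Ricci symmetric spacetimes of quasi-constant sectional curvature

Contracting the curvature hypothesis gives a Ricci tensor of perfect fluid form,
`R_{hk} = (3γ - μ) g_{hk} + 2μ A_h A_k` (`ricci_of_quasiConstant`). Since `∇ g = 0` (`pd_metric`),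
Ricci symmetry becomes
`∂_l (3γ - μ) g_{hk} + 2 ∂_l μ A_h A_k + 2μ (A_k ∇_l A_h + A_h ∇_l A_k) = 0`
(`covDeriv₂_perfect_fluid`). The unit condition gives `A^k ∇_l A_k = 0`
(`sum_mul_covDeriv₁_of_const_norm`). Contracting with `A^k` leaves
`∂_l (3γ - μ) A_h - 2 ∂_l μ A_h - 2μ ∇_l A_h = 0`; a second contraction with `A^h` shows that the
first two terms cancel, so that `μ ∇_l A_h = 0` (`eq_zero_of_perfect_fluid_derivative`). As `μ`
has no zeros, `A` is parallel (`IsQuasiConstant.isParallel`). A parallel unit timelike field is in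
particular Killing and irrotational, so `A` itself is the static vector field.

The Petrov type is determined by the curvature form alone. Inserting the Ricci tensor and the
scalar curvature `12γ - 6μ` into the Weyl tensor, everything cancels
(`weyl_eq_zero_of_quasiConstant`): the spacetime is conformally flat, and of type O at every point.

The computations take place in a chart `e`. The differentiability of the components used there
comes from the smoothness of the coordinate vectors `∂_i` as sections of the tangent bundle along
`e.symm` (`contMDiffAt_coordVec`).
-/

open scoped Manifold ContDiff

namespace QCSpacetime

/-! ### Rules of calculus for the partial derivatives -/

theorem pd_congr {f f' : E4 → ℝ} {y : E4} (h : f =ᶠ[nhds y] f') (l : Fin 4) :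
    pd l f y = pd l f' y := by
  unfold pd
  rw [h.fderiv_eq]

theorem pd_add {f f' : E4 → ℝ} {y : E4} (hf : DifferentiableAt ℝ f y)
    (hf' : DifferentiableAt ℝ f' y) (l : Fin 4) :
    pd l (fun z => f z + f' z) y = pd l f y + pd l f' y := by
  unfold pd
  rw [fderiv_fun_add hf hf']
  rfl

theorem pd_mul {f f' : E4 → ℝ} {y : E4} (hf : DifferentiableAt ℝ f y)
    (hf' : DifferentiableAt ℝ f' y) (l : Fin 4) :
    pd l (fun z => f z * f' z) y = pd l f y * f' y + f y * pd l f' y := by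
  unfold pd
  rw [fderiv_fun_mul hf hf']
  simp
  ring

theorem pd_sum {ι : Type*} (s : Finset ι) {f : ι → E4 → ℝ} {y : E4}
    (hf : ∀ i ∈ s, DifferentiableAt ℝ (f i) y) (l : Fin 4) :
    pd l (fun z => ∑ i ∈ s, f i z) y = ∑ i ∈ s, pd l (f i) y := by
  unfold pd
  rw [fderiv_fun_sum hf]
  simp

/-! ### Metric compatibility and covariant derivatives -/

/-- The Christoffel symbols with lowered upper index (Christoffel symbols of the first kind). -/
theorem sum_christoffel_mul {G : E4 → Matrix (Fin 4) (Fin 4) ℝ} {y : E4}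
    (hdet : IsUnit (G y).det) (hG : (G y).IsSymm) (l i j : Fin 4) :
    ∑ k, christoffel G k l i y * G y k j =
      (1 / 2) * (pd l (fun z => G z i j) y + pd i (fun z => G z l j) y
        - pd j (fun z => G z l i) y) := by
  have hinv (m) : ∑ k, G y j k * (G y)⁻¹ k m = if j = m then 1 else 0 := by
    rw [← Matrix.mul_apply, Matrix.mul_nonsing_inv _ hdet, Matrix.one_apply]
  calc _ = (1 / 2) * ∑ m, (∑ k, G y j k * (G y)⁻¹ k m) *
        (pd l (fun z => G z i m) y + pd i (fun z => G z l m) y - pd m (fun z => G z l i) y) := by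
        simp only [christoffel, Finset.mul_sum, Finset.sum_mul]
        rw [Finset.sum_comm]
        refine Finset.sum_congr rfl fun m _ => Finset.sum_congr rfl fun k _ => ?_
        rw [hG.apply k j]
        ring
    _ = _ := by simp [hinv]

/-- The metric is parallel, `∇_l g_{ij} = 0`, written as a formula for `∂_l g_{ij}`. -/
theorem pd_metric {G : E4 → Matrix (Fin 4) (Fin 4) ℝ} {y : E4}
    (hdet : IsUnit (G y).det) (hG : ∀ᶠ z in nhds y, (G z).IsSymm) (l i j : Fin 4) :
    pd l (fun z => G z i j) y =
      ∑ k, christoffel G k l i y * G y k j + ∑ k, christoffel G k l j y * G y i k := by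
  have h (a b l) : pd l (fun z => G z a b) y = pd l (fun z => G z b a) y := by
    unfold pd
    rw [Filter.EventuallyEq.fderiv_eq (hG.mono fun z hz => hz.apply b a)]
  have hy := hG.self_of_nhds
  simp only [hy.apply _ i]
  rw [sum_christoffel_mul hdet hy, sum_christoffel_mul hdet hy, h j i l, h l j i, h l i j]
  ring

/-- The covariant derivative of a tensor field of the form `u g_{ij} + v α_i α_j`, by the Leibniz
rule and `∇ g = 0`. -/
theorem covDeriv₂_perfect_fluid {G : E4 → Matrix (Fin 4) (Fin 4) ℝ} {y : E4}
    {T : Fin 4 → Fin 4 → E4 → ℝ} {α : Fin 4 → E4 → ℝ} {u v : E4 → ℝ}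
    (hdet : IsUnit (G y).det) (hG : ∀ᶠ z in nhds y, (G z).IsSymm)
    (hGd : ∀ i j, DifferentiableAt ℝ (fun z => G z i j) y)
    (hα : ∀ i, DifferentiableAt ℝ (α i) y)
    (hu : DifferentiableAt ℝ u y) (hv : DifferentiableAt ℝ v y)
    (hT : ∀ᶠ z in nhds y, ∀ i j, T i j z = u z * G z i j + v z * (α i z * α j z))
    (l i j : Fin 4) :
    covDeriv₂ G T l i j y = pd l u y * G y i j + pd l v y * (α i y * α j y)
      + v y * (covDeriv₁ G α l i y * α j y + α i y * covDeriv₁ G α l j y) := by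
  have hd : pd l (T i j) y = (pd l u y * G y i j + u y * pd l (fun z => G z i j) y)
      + (pd l v y * (α i y * α j y) +
        v y * (pd l (α i) y * α j y + α i y * pd l (α j) y)) := by
    rw [pd_congr (hT.mono fun z hz => hz i j), pd_add (by fun_prop) (by fun_prop),
      pd_mul (by fun_prop) (by fun_prop), pd_mul (by fun_prop) (by fun_prop),
      pd_mul (by fun_prop) (by fun_prop)]
  have hTy := hT.self_of_nhds
  unfold covDeriv₂ covDeriv₁
  simp only [hTy]
  rw [hd, pd_metric hdet hG]
  simp only [mul_add, mul_sub, sub_mul, Finset.sum_add_distrib, Finset.mul_sum,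
    Finset.sum_mul]
  have e1 : ∑ k, christoffel G k l i y * (v y * (α k y * α j y)) =
      ∑ k, v y * (christoffel G k l i y * α k y * α j y) :=
    Finset.sum_congr rfl fun k _ => by ring
  have e2 : ∑ k, christoffel G k l j y * (v y * (α i y * α k y)) =
      ∑ k, v y * (α i y * (christoffel G k l j y * α k y)) :=
    Finset.sum_congr rfl fun k _ => by ring
  have e3 : ∑ k, christoffel G k l i y * (u y * G y k j) =
      ∑ k, u y * (christoffel G k l i y * G y k j) :=
    Finset.sum_congr rfl fun k _ => by ring
  have e4 : ∑ k, christoffel G k l j y * (u y * G y i k) =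
      ∑ k, u y * (christoffel G k l j y * G y i k) :=
    Finset.sum_congr rfl fun k _ => by ring
  rw [e1, e2, e3, e4]
  ring

/-- If a vector field `β` with covariant components `α` has constant `g(β, β)`, then
`β^j ∇_l α_j = 0`. -/
theorem sum_mul_covDeriv₁_of_const_norm {G : E4 → Matrix (Fin 4) (Fin 4) ℝ} {y : E4}
    {α β : Fin 4 → E4 → ℝ}
    (hdet : IsUnit (G y).det) (hG : ∀ᶠ z in nhds y, (G z).IsSymm)
    (hGd : ∀ i j, DifferentiableAt ℝ (fun z => G z i j) y)
    (hβ : ∀ i, DifferentiableAt ℝ (β i) y)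
    (hαβ : ∀ᶠ z in nhds y, ∀ i, α i z = ∑ j, G z i j * β j z)
    {c : ℝ} (hc : ∀ᶠ z in nhds y, ∑ i, β i z * α i z = c) (l : Fin 4) :
    ∑ j, β j y * covDeriv₁ G α l j y = 0 := by
  have hGy := hG.self_of_nhds
  have hα (i) : DifferentiableAt ℝ (α i) y :=
    DifferentiableAt.congr_of_eventuallyEq (by fun_prop) (hαβ.mono fun z hz => hz i)
  have hdα (i) : pd l (α i) y =
      ∑ j, (pd l (fun z => G z i j) y * β j y + G y i j * pd l (β j) y) := by
    rw [pd_congr (hαβ.mono fun z hz => hz i), pd_sum _ fun j _ => by fun_prop]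
    exact Finset.sum_congr rfl fun j _ => pd_mul (hGd i j) (hβ j) l
  have h0 : ∑ i, (pd l (β i) y * α i y + β i y * pd l (α i) y) = 0 := by
    have : pd l (fun z => ∑ i, β i z * α i z) y = 0 := by
      rw [pd_congr hc]
      simp [pd]
    rw [pd_sum _ fun j _ => by fun_prop] at this
    rw [← this]
    exact Finset.sum_congr rfl fun j _ => (pd_mul (hβ j) (hα j) l).symm
  have hαy := hαβ.self_of_nhds
  have h1 : ∑ i, β i y * ∑ j, G y i j * pd l (β j) y = ∑ j, pd l (β j) y * α j y := by
    simp only [hαy, Finset.mul_sum]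
    rw [Finset.sum_comm]
    refine Finset.sum_congr rfl fun i _ => Finset.sum_congr rfl fun j _ => ?_
    rw [hGy.apply i j]; ring
  set S := ∑ i, β i y * ∑ j, pd l (fun z => G z i j) y * β j y with hS
  have h2 : ∑ i, β i y * pd l (α i) y = S + ∑ j, pd l (β j) y * α j y := by
    rw [← h1, hS, ← Finset.sum_add_distrib]
    refine Finset.sum_congr rfl fun i _ => ?_
    rw [hdα, Finset.sum_add_distrib, mul_add]
  rw [Finset.sum_add_distrib, h2] at h0
  set K := ∑ j, β j y * ∑ k, christoffel G k l j y * α k y with hK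
  -- `S = β^i β^j ∂_l g_{ij}` is twice the Christoffel term `K`, since `∇ g = 0`.
  have h3 : S = K + K := by
    have e1 : K = ∑ i, β i y * ∑ j, (∑ k, christoffel G k l i y * G y k j) * β j y := by
      refine Finset.sum_congr rfl fun i _ => ?_
      congr 1
      simp only [hαy, Finset.mul_sum, Finset.sum_mul]
      rw [Finset.sum_comm]
      exact Finset.sum_congr rfl fun j _ => Finset.sum_congr rfl fun k _ => by ring
    have e2 : K = ∑ i, β i y * ∑ j, (∑ k, christoffel G k l j y * G y i k) * β j y := by
      rw [e1]
      simp only [Finset.mul_sum, Finset.sum_mul]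
      rw [Finset.sum_comm]
      refine Finset.sum_congr rfl fun i _ => Finset.sum_congr rfl fun j _ =>
        Finset.sum_congr rfl fun k _ => ?_
      rw [hGy.apply i k]; ring
    refine Eq.trans ?_ (congrArg₂ HAdd.hAdd e1 e2).symm
    rw [← Finset.sum_add_distrib, hS]
    refine Finset.sum_congr rfl fun i _ => ?_
    rw [← mul_add, ← Finset.sum_add_distrib]
    simp only [← add_mul, ← pd_metric hdet hG l i _]
  calc ∑ j, β j y * covDeriv₁ G α l j y
      = ∑ j, β j y * pd l (α j) y - K := by
        rw [hK, ← Finset.sum_sub_distrib]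
        exact Finset.sum_congr rfl fun j _ => by unfold covDeriv₁; ring
    _ = 0 := by rw [h2]; linarith

/-- The pointwise algebra behind the parallelism of the generator. Here `t` stands for `∇_l a`, and
`p`, `q` for the derivatives of the coefficients of `g` and `a ⊗ a` in the Ricci tensor; the
hypothesis `h` says that the Ricci tensor is parallel in the direction `l`. -/
theorem eq_zero_of_perfect_fluid_derivative {G : Matrix (Fin 4) (Fin 4) ℝ}
    {a b t : Fin 4 → ℝ} {p q m : ℝ}
    (hab : ∀ i, a i = ∑ j, G i j * b j) (hu : ∑ i, b i * a i = -1)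
    (ht : ∑ i, b i * t i = 0) (hm : m ≠ 0)
    (h : ∀ i j, p * G i j + q * (a i * a j) + m * (t i * a j + a i * t j) = 0) (i : Fin 4) :
    t i = 0 := by
  -- Contraction of `h` with `b`, and in `hpq` a second one.
  have hcontr (i) : (p - q) * a i - m * t i = 0 := by
    have : ∑ j, b j * (p * G i j + q * (a i * a j) + m * (t i * a j + a i * t j)) = 0 := by
      simp [h]
    have e : ∑ j, b j * (p * G i j + q * (a i * a j) + m * (t i * a j + a i * t j)) =
        p * ∑ j, G i j * b j + q * a i * ∑ j, b j * a j
          + m * (t i * ∑ j, b j * a j + a i * ∑ j, b j * t j) := by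
      simp only [Finset.mul_sum, ← Finset.sum_add_distrib]
      exact Finset.sum_congr rfl fun j _ => by ring
    rw [e, ← hab, hu, ht] at this
    linarith
  have hpq : p - q = 0 := by
    have : ∑ i, b i * ((p - q) * a i - m * t i) = 0 := by simp [hcontr]
    have e : ∑ i, b i * ((p - q) * a i - m * t i) =
        (p - q) * ∑ i, b i * a i - m * ∑ i, b i * t i := by
      simp only [Finset.mul_sum, ← Finset.sum_sub_distrib]
      exact Finset.sum_congr rfl fun j _ => by ring
    rw [e, hu, ht] at this
    linarith
  have := hcontr i
  rw [hpq] at this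
  have h2 : m * t i = 0 := by linarith
  exact (mul_eq_zero.1 h2).resolve_left hm

/-! ### Ricci and Weyl tensors of quasi-constant curvature -/

theorem sum_inv_mul_self {g : Matrix (Fin 4) (Fin 4) ℝ} (hdet : IsUnit g.det) (hg : g.IsSymm) :
    ∑ i, ∑ j, g⁻¹ i j * g i j = 4 := by
  have h (i) : ∑ j, g⁻¹ i j * g i j = 1 := by
    rw [← Matrix.one_apply_eq (α := ℝ) i, ← Matrix.nonsing_inv_mul _ hdet, Matrix.mul_apply]
    exact Finset.sum_congr rfl fun j _ => by rw [hg.apply j i]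
  simp [h]

/-- The Ricci tensor of a space of quasi-constant curvature has the perfect fluid form
`R_{hk} = (3γ - μ) g_{hk} + 2μ A_h A_k`. -/
theorem ricci_of_quasiConstant {G : E4 → Matrix (Fin 4) (Fin 4) ℝ} {y : E4}
    {a b : Fin 4 → ℝ} {c m : ℝ} (hdet : IsUnit (G y).det) (hG : (G y).IsSymm)
    (hab : ∀ i, ∑ j, (G y)⁻¹ i j * a j = b i) (hu : ∑ i, b i * a i = -1)
    (hR : ∀ h i j k, riemann G h i j k y =
      c * (G y h k * G y i j - G y h j * G y i k)
        + m * (G y h k * a i * a j + G y i j * a h * a k - G y h j * a i * a k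
          - G y i k * a h * a j)) (h k : Fin 4) :
    ricci G h k y = (3 * c - m) * G y h k + 2 * m * (a h * a k) := by
  unfold ricci
  simp only [hR]
  set g := G y
  have hsym (i j) : g i j = g j i := hG.apply j i
  have hisym (i j) : g⁻¹ i j = g⁻¹ j i := (Matrix.IsSymm.inv hG).apply j i
  have hI (i j) : ∑ k, g⁻¹ i k * g k j = if i = j then 1 else 0 := by
    rw [← Matrix.mul_apply, Matrix.nonsing_inv_mul _ hdet, Matrix.one_apply]
  have h2 (i) : ∑ j, g⁻¹ i j * g h j = if i = h then 1 else 0 := by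
    rw [← hI]
    exact Finset.sum_congr rfl fun j _ => by rw [hsym h j]
  -- For fixed `i`, the contraction over `j` splits into three basic ones.
  have hi (i) : ∑ j, g⁻¹ i j *
      (c * (g h k * g i j - g h j * g i k)
        + m * (g h k * a i * a j + g i j * a h * a k - g h j * a i * a k - g i k * a h * a j)) =
      (c * g h k + m * a h * a k) * ∑ j, g⁻¹ i j * g i j
        - (c * g i k + m * a i * a k) * ∑ j, g⁻¹ i j * g h j
        + m * g h k * (a i * ∑ j, g⁻¹ i j * a j)
        - m * a h * (g i k * ∑ j, g⁻¹ i j * a j) := by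
    simp only [Finset.mul_sum, ← Finset.sum_add_distrib, ← Finset.sum_sub_distrib]
    exact Finset.sum_congr rfl fun j _ => by ring
  have h5 : ∑ i, g i k * b i = a k := by
    simp only [← hab, Finset.mul_sum]
    rw [Finset.sum_comm]
    have h6 (j) : ∑ i, g i k * (g⁻¹ i j * a j) = (if j = k then 1 else 0) * a j := by
      rw [← hI, Finset.sum_mul]
      exact Finset.sum_congr rfl fun i _ => by rw [hisym j i]; ring
    simp [h6]
  have h3 : ∑ i, a i * b i = -1 := by rw [← hu]; exact Finset.sum_congr rfl fun i _ => by ring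
  simp only [hi, h2, hab]
  rw [Finset.sum_sub_distrib, Finset.sum_add_distrib, Finset.sum_sub_distrib, ← Finset.mul_sum,
    ← Finset.mul_sum, ← Finset.mul_sum, h5, h3, sum_inv_mul_self hdet hG]
  simp
  ring

/-- A metric of quasi-constant curvature is conformally flat: its curvature tensor is a combination
of `g ∧ g` and `g ∧ (A ⊗ A)` (Kulkarni–Nomizu products), and the trace-free part of these is zero. -/
theorem weyl_eq_zero_of_quasiConstant {G : E4 → Matrix (Fin 4) (Fin 4) ℝ} {y : E4}
    {a b : Fin 4 → ℝ} {c m : ℝ} (hdet : IsUnit (G y).det) (hG : (G y).IsSymm)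
    (hab : ∀ i, ∑ j, (G y)⁻¹ i j * a j = b i) (hu : ∑ i, b i * a i = -1)
    (hR : ∀ h i j k, riemann G h i j k y =
      c * (G y h k * G y i j - G y h j * G y i k)
        + m * (G y h k * a i * a j + G y i j * a h * a k - G y h j * a i * a k
          - G y i k * a h * a j)) (h i j k : Fin 4) :
    weyl G h i j k y = 0 := by
  have hRic := ricci_of_quasiConstant hdet hG hab hu hR
  have hS : scalarCurv G y = 4 * (3 * c - m) - 2 * m := by
    unfold scalarCurv
    simp only [hRic]
    have hi (i) : ∑ j, (G y)⁻¹ i j * ((3 * c - m) * G y i j + 2 * m * (a i * a j)) =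
        (3 * c - m) * ∑ j, (G y)⁻¹ i j * G y i j
          + 2 * m * (∑ j, (G y)⁻¹ i j * a j) * a i := by
      simp only [Finset.mul_sum, Finset.sum_mul, ← Finset.sum_add_distrib]
      exact Finset.sum_congr rfl fun j _ => by ring
    simp only [hi, hab]
    simp only [mul_assoc]
    rw [Finset.sum_add_distrib, ← Finset.mul_sum, ← Finset.mul_sum, sum_inv_mul_self hdet hG,
      ← Finset.mul_sum, hu]
    ring
  unfold weyl
  rw [hR, hS]
  simp only [hRic]
  ring

/-! ### Differentiability of the inverse of a matrix function -/

theorem differentiableAt_matrix_det {n : Type*} [Fintype n] [DecidableEq n]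
    {E : Type*} [NormedAddCommGroup E] [NormedSpace ℝ E]
    {G : E → Matrix n n ℝ} {y : E}
    (hG : ∀ i j, DifferentiableAt ℝ (fun z => G z i j) y) :
    DifferentiableAt ℝ (fun z => (G z).det) y := by
  simp only [Matrix.det_apply]
  refine DifferentiableAt.fun_sum fun σ _ => DifferentiableAt.const_smul ?_ _
  exact (HasFDerivAt.finsetProd fun i _ => (hG (σ i) i).hasFDerivAt).differentiableAt

theorem differentiableAt_matrix_inv {n : Type*} [Fintype n] [DecidableEq n]
    {E : Type*} [NormedAddCommGroup E] [NormedSpace ℝ E]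
    {G : E → Matrix n n ℝ} {y : E} (hdet : IsUnit (G y).det)
    (hG : ∀ i j, DifferentiableAt ℝ (fun z => G z i j) y) (i j : n) :
    DifferentiableAt ℝ (fun z => (G z)⁻¹ i j) y := by
  simp only [Matrix.inv_def, Ring.inverse_eq_inv', Matrix.smul_apply, Matrix.adjugate_apply,
    smul_eq_mul]
  refine ((differentiableAt_matrix_det hG).fun_inv hdet.ne_zero).fun_mul
    (differentiableAt_matrix_det fun k l => ?_)
  by_cases h : k = j
  · simp [h, Matrix.updateRow_self]
  · simpa [Matrix.updateRow_ne h] using hG k l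

/-! ### Smoothness of components in a chart -/

attribute [local instance 2000] chartedSpaceSelf

variable {M : Type*} [TopologicalSpace M] [ChartedSpace E4 M]

/-- The coordinate vectors `∂_i` span each tangent space. -/
theorem exists_eq_sum_coordVec {e : OpenPartialHomeomorph M E4}
    (he : e ∈ IsManifold.maximalAtlas (𝓡 4) ∞ M) {y : E4} (hy : y ∈ e.target)
    (v : TangentSpace (𝓡 4) (e.symm y)) : ∃ b : Fin 4 → ℝ, v = ∑ i, b i • coordVec e i y := by
  have hd : e.MDifferentiable (𝓡 4) (𝓡 4) :=
    ⟨(contMDiffOn_of_mem_maximalAtlas he).mdifferentiableOn (by simp),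
      (contMDiffOn_symm_of_mem_maximalAtlas he).mdifferentiableOn (by simp)⟩
  obtain ⟨w, rfl⟩ := hd.symm.mfderiv_surjective hy v
  let φ : E4 →L[ℝ] TangentSpace (𝓡 4) (e.symm y) := mfderiv (𝓡 4) (𝓡 4) e.symm y
  let w' : E4 := w
  refine ⟨fun i => w' i, ?_⟩
  change φ w' = ∑ i, w' i • φ (EuclideanSpace.single i (1 : ℝ))
  conv_lhs => rw [← (EuclideanSpace.basisFun (Fin 4) ℝ).sum_repr w']
  rw [map_sum]
  simp only [map_smul, EuclideanSpace.basisFun_repr, EuclideanSpace.basisFun_apply]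

theorem differentiableAt_comp_symm {f : M → ℝ} (hf : ContMDiff (𝓡 4) 𝓘(ℝ, ℝ) ∞ f)
    {e : OpenPartialHomeomorph M E4} (he : e ∈ IsManifold.maximalAtlas (𝓡 4) ∞ M) {y : E4}
    (hy : y ∈ e.target) : DifferentiableAt ℝ (fun z => f (e.symm z)) y :=
  (((hf (e.symm y)).comp y (contMDiffAt_symm_of_mem_maximalAtlas he hy)).mdifferentiableAt
    (by simp)).differentiableAt

variable [IsManifold (𝓡 4) ∞ M]

/-- The section `∂_i` along `e.symm` is the tangent map of `e.symm` applied to a constant vector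
field. -/
theorem contMDiffAt_coordVec {e : OpenPartialHomeomorph M E4}
    (he : e ∈ IsManifold.maximalAtlas (𝓡 4) ∞ M) {y : E4} (hy : y ∈ e.target) (i : Fin 4) :
    ContMDiffAt (𝓡 4) (𝓡 4).tangent ∞
      (fun z : E4 => (⟨e.symm z, coordVec e i z⟩ : TangentBundle (𝓡 4) M)) y := by
  have hs := contMDiffOn_symm_of_mem_maximalAtlas he
  have ht := hs.contMDiffOn_tangentMapWithin (m := ∞) (by simp) e.open_target.uniqueMDiffOn
  have hc : ContMDiffAt (𝓡 4) (𝓡 4).tangent ∞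
      (fun z : E4 => (⟨z, (EuclideanSpace.single i (1 : ℝ) : E4)⟩ : TangentBundle (𝓡 4) E4)) y :=
    contMDiffAt_vectorSpace_iff_contDiffAt.2 contDiffAt_const
  have hty := (ht ⟨y, (EuclideanSpace.single i (1 : ℝ) : E4)⟩ hy).contMDiffAt
    ((e.open_target.preimage
    (FiberBundle.continuous_proj E4 (TangentSpace (𝓡 4) (M := E4)))).mem_nhds hy)
  refine (hty.comp y hc).congr_of_eventuallyEq ?_
  filter_upwards [e.open_target.mem_nhds hy] with z hz
  simp only [Function.comp, tangentMapWithin, coordVec,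
    mfderivWithin_of_isOpen e.open_target hz]

/-- If `V` and `W` are smooth vector fields along the inverse chart `e.symm`, then `g(V, W)` is a
smooth function of the coordinates. -/
theorem LorentzianMetric.contMDiffAt_apply (g : LorentzianMetric M) {e : OpenPartialHomeomorph M E4}
    (he : e ∈ IsManifold.maximalAtlas (𝓡 4) ∞ M) {y : E4} (hy : y ∈ e.target)
    {V W : ∀ z : E4, TangentSpace (𝓡 4) (e.symm z)}
    (hV : ContMDiffAt (𝓡 4) (𝓡 4).tangent ∞
      (fun z : E4 => (⟨e.symm z, V z⟩ : TangentBundle (𝓡 4) M)) y)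
    (hW : ContMDiffAt (𝓡 4) (𝓡 4).tangent ∞
      (fun z : E4 => (⟨e.symm z, W z⟩ : TangentBundle (𝓡 4) M)) y) :
    ContMDiffAt (𝓡 4) 𝓘(ℝ, ℝ) ∞ (fun z => g.val (e.symm z) (V z) (W z)) y := by
  have hs := contMDiffAt_symm_of_mem_maximalAtlas he hy
  have : ContMDiffAt (𝓡 4) ((𝓡 4).prod 𝓘(ℝ)) ∞
      (fun m ↦ Bundle.TotalSpace.mk' ℝ (E := Bundle.Trivial M ℝ) (e.symm m)
        (g.val (e.symm m) (V m) (W m))) y := by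
    apply ContMDiffAt.clm_bundle_apply₂ (F₁ := E4) (F₂ := E4)
    · exact (g.contMDiff _).comp y hs
    · exact hV
    · exact hW
  simp only [Bundle.contMDiffAt_totalSpace] at this
  exact this.2

theorem LorentzianMetric.differentiableAt_comp (g : LorentzianMetric M)
    {e : OpenPartialHomeomorph M E4} (he : e ∈ IsManifold.maximalAtlas (𝓡 4) ∞ M) {y : E4}
    (hy : y ∈ e.target) (i j : Fin 4) : DifferentiableAt ℝ (fun z => g.comp e z i j) y :=
  ((g.contMDiffAt_apply he hy (contMDiffAt_coordVec he hy i)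
    (contMDiffAt_coordVec he hy j)).mdifferentiableAt (by simp)).differentiableAt

theorem LorentzianMetric.differentiableAt_lower (g : LorentzianMetric M)
    {A : ∀ x : M, TangentSpace (𝓡 4) x} (hA : IsSmoothVectorField A)
    {e : OpenPartialHomeomorph M E4} (he : e ∈ IsManifold.maximalAtlas (𝓡 4) ∞ M) {y : E4}
    (hy : y ∈ e.target) (i : Fin 4) : DifferentiableAt ℝ (g.lower A e i) y :=
  ((g.contMDiffAt_apply he hy
    ((hA (e.symm y)).comp y (contMDiffAt_symm_of_mem_maximalAtlas he hy))
    (contMDiffAt_coordVec he hy i)).mdifferentiableAt (by simp)).differentiableAt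

/-! ### Frames and the unit condition in coordinates -/

theorem LorentzianMetric.isSymm_comp (g : LorentzianMetric M) (e : OpenPartialHomeomorph M E4)
    (y : E4) : (g.comp e y).IsSymm :=
  Matrix.IsSymm.ext fun _ _ => g.symm _ _ _

/-- The Lorentz basis from the signature condition, expanded in the coordinate vectors. -/
theorem LorentzianMetric.exists_isLorentzFrame (g : LorentzianMetric M)
    {e : OpenPartialHomeomorph M E4} (he : e ∈ IsManifold.maximalAtlas (𝓡 4) ∞ M) {y : E4}
    (hy : y ∈ e.target) : ∃ F, IsLorentzFrame (g.comp e) y F := by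
  obtain ⟨b, hb⟩ := g.signature (e.symm y)
  choose F hF using fun a => exists_eq_sum_coordVec he hy (b a)
  refine ⟨Matrix.of F, ?_⟩
  unfold IsLorentzFrame
  ext a c
  rw [← hb, hF a, hF c]
  simp only [Matrix.mul_apply, Matrix.transpose_apply, Matrix.of_apply, map_sum, map_smul,
    sum_apply, smul_apply, smul_eq_mul,
    LorentzianMetric.comp, Finset.sum_mul, Finset.mul_sum]
  refine Finset.sum_congr rfl fun j _ => Finset.sum_congr rfl fun i _ => ?_
  ring

theorem IsLorentzFrame.isUnit_det {G : E4 → Matrix (Fin 4) (Fin 4) ℝ} {y : E4}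
    {F : Matrix (Fin 4) (Fin 4) ℝ} (h : IsLorentzFrame G y F) : IsUnit (G y).det := by
  have hd := congrArg Matrix.det h
  rw [Matrix.det_mul, Matrix.det_mul, minkowski, Matrix.det_diagonal] at hd
  refine isUnit_iff_ne_zero.2 fun h0 => ?_
  rw [h0] at hd
  simp [Fin.prod_univ_four] at hd

/-- `g^{ij} A_i A_j = g(A, A)`. -/
theorem LorentzianMetric.sum_inv_mul_lower_mul_lower (g : LorentzianMetric M)
    (A : ∀ x : M, TangentSpace (𝓡 4) x)
    {e : OpenPartialHomeomorph M E4} (he : e ∈ IsManifold.maximalAtlas (𝓡 4) ∞ M) {y : E4}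
    (hy : y ∈ e.target) :
    ∑ i, (∑ j, (g.comp e y)⁻¹ i j * g.lower A e j y) * g.lower A e i y =
      g.val (e.symm y) (A (e.symm y)) (A (e.symm y)) := by
  obtain ⟨F, hF⟩ := g.exists_isLorentzFrame he hy
  have hdet := hF.isUnit_det
  obtain ⟨b, hb⟩ := exists_eq_sum_coordVec he hy (A (e.symm y))
  have hl (i) : g.lower A e i y = (g.comp e y).mulVec b i := by
    unfold LorentzianMetric.lower
    rw [hb]
    simp only [Matrix.mulVec, dotProduct, map_sum, map_smul, sum_apply,
      smul_apply, smul_eq_mul, LorentzianMetric.comp, Matrix.of_apply]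
    exact Finset.sum_congr rfl fun j _ => by rw [g.symm]; ring
  have hi (i) : ∑ j, (g.comp e y)⁻¹ i j * g.lower A e j y = b i := by
    simp only [hl]
    change ((g.comp e y)⁻¹.mulVec ((g.comp e y).mulVec b)) i = b i
    rw [Matrix.mulVec_mulVec, Matrix.nonsing_inv_mul _ hdet, Matrix.one_mulVec]
  simp only [hi]
  rw [congrArg (g.val (e.symm y) (A (e.symm y))) hb, map_sum]
  simp only [map_smul, smul_eq_mul]
  rfl

/-! ### The geometric conclusions -/

theorem IsQuasiConstant.isParallel {g : LorentzianMetric M}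
    {A : ∀ x : M, TangentSpace (𝓡 4) x} {γ μ : M → ℝ} (hQC : IsQuasiConstant g A γ μ)
    (hμ : ∀ x, μ x ≠ 0) (hRic : IsRicciSymmetric g) : IsParallel g A := by
  intro e he y hy l j
  have hev : ∀ᶠ z in nhds y, z ∈ e.target := e.open_target.mem_nhds hy
  have hdet {z} (hz : z ∈ e.target) : IsUnit (g.comp e z).det :=
    let ⟨_, hF⟩ := g.exists_isLorentzFrame he hz
    hF.isUnit_det
  have hG : ∀ᶠ z in nhds y, (g.comp e z).IsSymm := .of_forall (g.isSymm_comp e)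
  have hGd := g.differentiableAt_comp he hy
  have hα := g.differentiableAt_lower hQC.smooth_generator he hy
  have hγd := differentiableAt_comp_symm hQC.smooth_gamma he hy
  have hμd := differentiableAt_comp_symm hQC.smooth_mu he hy
  -- the contravariant components `A^i`
  let β : Fin 4 → E4 → ℝ := fun i z => ∑ j, (g.comp e z)⁻¹ i j * g.lower A e j z
  have hβ (i) : DifferentiableAt ℝ (β i) y :=
    DifferentiableAt.fun_sum fun j _ =>
      (differentiableAt_matrix_inv (hdet hy) hGd i j).fun_mul (hα j)
  have hαβ : ∀ z ∈ e.target, ∀ i, g.lower A e i z = ∑ j, g.comp e z i j * β j z := by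
    intro z hz i
    change _ = ((g.comp e z).mulVec ((g.comp e z)⁻¹.mulVec fun i => g.lower A e i z)) i
    rw [Matrix.mulVec_mulVec, Matrix.mul_nonsing_inv _ (hdet hz), Matrix.one_mulVec]
  have hunit : ∀ z ∈ e.target, ∑ i, β i z * g.lower A e i z = -1 := fun z hz => by
    rw [g.sum_inv_mul_lower_mul_lower A he hz, hQC.unit_timelike]
  have hT : ∀ z ∈ e.target, ∀ i j, ricci (g.comp e) i j z =
      (3 * γ (e.symm z) - μ (e.symm z)) * g.comp e z i j
        + 2 * μ (e.symm z) * (g.lower A e i z * g.lower A e j z) := fun z hz =>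
    ricci_of_quasiConstant (hdet hz) (g.isSymm_comp e z) (fun _ => rfl) (hunit z hz)
      (hQC.curvature e he z hz)
  have hD (i k) := (covDeriv₂_perfect_fluid (hdet hy) hG hGd hα
    ((hγd.const_mul 3).fun_sub hμd) (hμd.const_mul 2) (hev.mono hT) l i k).symm.trans
      (hRic e he y hy l i k)
  exact eq_zero_of_perfect_fluid_derivative (hαβ y hy) (hunit y hy)
    (sum_mul_covDeriv₁_of_const_norm (hdet hy) hG hGd hβ (hev.mono hαβ) (hev.mono hunit) l)
    (mul_ne_zero two_ne_zero (hμ (e.symm y))) hD j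

/-- For a parallel vector field all terms of the Killing and irrotationality equations vanish. -/
theorem isStaticVectorField_of_isParallel {g : LorentzianMetric M}
    {A : ∀ x : M, TangentSpace (𝓡 4) x} (hA : IsSmoothVectorField A)
    (ht : ∀ x, g.val x (A x) (A x) < 0) (hp : IsParallel g A) : IsStaticVectorField g A where
  smooth := hA
  timelike := ht
  killing e he y hy i j := by rw [hp e he y hy, hp e he y hy, add_zero]
  irrotational e he y hy i j k := by simp only [hp e he y hy, sub_zero, mul_zero, add_zero]

/-- A spacetime of quasi-constant curvature is of type O everywhere, because its Weyl tensor
vanishes. -/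
theorem IsQuasiConstant.isPetrovO {g : LorentzianMetric M}
    {A : ∀ x : M, TangentSpace (𝓡 4) x} {γ μ : M → ℝ} (hQC : IsQuasiConstant g A γ μ)
    {e : OpenPartialHomeomorph M E4} (he : e ∈ IsManifold.maximalAtlas (𝓡 4) ∞ M) {y : E4}
    (hy : y ∈ e.target) : IsPetrovO (g.comp e) y := by
  obtain ⟨F, hF⟩ := g.exists_isLorentzFrame he hy
  have hW := weyl_eq_zero_of_quasiConstant hF.isUnit_det (g.isSymm_comp e y) (fun _ => rfl)
    ((g.sum_inv_mul_lower_mul_lower A he hy).trans (hQC.unit_timelike _))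
    (hQC.curvature e he y hy)
  refine ⟨F, hF, ?_⟩
  ext a b
  simp [petrovMatrix, weylFrame, hW]

end QCSpacetime

theorem theorem1p5 {M : Type*} [TopologicalSpace M] [ChartedSpace QCSpacetime.E4 M]
    [IsManifold (𝓡 4) ∞ M] (g : QCSpacetime.LorentzianMetric M)
    (A : ∀ x : M, TangentSpace (𝓡 4) x) (γ μ : M → ℝ)
    (hQC : QCSpacetime.IsQuasiConstant g A γ μ) (hμ : ∀ x, μ x ≠ 0)
    (hRic : QCSpacetime.IsRicciSymmetric g) :
    QCSpacetime.IsParallel g A ∧ QCSpacetime.IsStatic g ∧ QCSpacetime.IsPetrovIDO g := by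
  have hA := hQC.isParallel hμ hRic
  refine ⟨hA, ⟨A, QCSpacetime.isStaticVectorField_of_isParallel hQC.smooth_generator
    (fun x => ?_) hA⟩, fun e he y hy => Or.inr (Or.inr (hQC.isPetrovO he hy))⟩
  rw [hQC.unit_timelike]
  norm_num
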